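/- For $n\ge 2$ let $Q=(Q_1,\dots,Q_n)$ be uniformly distributed on the $n!$ permutations of $\{1,\dots,n\}$ and let $Z_i=\sqrt{\tfrac{12}{n^2-1}}\,\bigl(Q_i-\tfrac{n+1}{2}\bigr)$, $i=1,\dots,n$. For a finite non-empty set $A$ the joint cumulant of random variables $(\xi_i)_{i\in A}$ is $$\mathbf C\{\xi_i\}_{i\in A}=\sum_{\sigma}(-1)^{\#\sigma-1}(\#\sigma-1)!\prod_{B\in\sigma}\mathbb E\prod_{i\in B}\xi_i ,$$ where $\sigma$ runs over the partitions of $A$ and $\#\sigma$ is the number of blocks of $\sigma$. Let $k_1,\dots,k_r$ be nonnegative integers, $k=k_1+\dots+k_r$, and $\mathbf k_i=2(k_1+\dots+k_i)$ with $\mathbf k_0=0$. Let $\pi_1$ be the perfect matching of $\{1,\dots,2k\}$ whose blocks are, for each $i$ with $k_i\geq 1$, $$\{\mathbf k_{i-1}+2,\mathbf k_{i-1}+3\},\ \{\mathbf k_{i-1}+4,\mathbf k_{i-1}+5\},\ \dots,\ \{\mathbf k_i-2,\mathbf k_i-1\},\ \{\mathbf k_i,\mathbf k_{i-1}+1\}.$$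 Let $\pi$ be a partition of $\{1,\dots,2k\}$ all of whose blocks have even cardinality, let $\mathfrak n_\gamma(\pi)$ be the number of blocks of $\pi$ of cardinality $2\gamma$, and let $\pi_1\vee\pi$ be the least upper bound of $\pi_1$ and $\pi$ in the lattice of partitions ordered by refinement ($\pi\le\sigma$ when every block of $\pi$ is contained in a block of $\sigma$). An $(n,2k)$-word is a vector $\mathbf j=(j_1,\dots,j_{2k})\in\{1,\dots,n\}^{2k}$; it is $\pi_1$-measurable if $j_\alpha=j_\beta$ whenever $\alpha,\beta$ lie in the same block of $\pi_1$. Put $\mathbf C_\pi(\mathbf j)=\prod_{A\in\pi}\mathbf C\{Z_{j_\alpha}\}_{\alpha\in A}$. Then, as $n\to\infty$ with $k_1,\dots,k_r$ and $\pi$ fixed, $$\sum_{\substack{\mathbf j\ (n,2k)\text{-word}\\ \pi_1\text{-measurable}}}\bigl|\mathbf C_\pi(\mathbf j)\bigr| = O\Bigl(n^{\,\#(\pi_1\vee\pi)+\sum_{\gamma\ge2}(\gamma-2)\,\mathfrak n_\gamma(\pi)}\Bigr).$$ -/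

import Mathlib

open Filter Asymptotics
open scoped Nat

noncomputable section

namespace Spearman

/-- Expectation with respect to the uniform distribution on a finite set. -/
def uniformExpect {Ω : Type*} [Fintype Ω] (f : Ω → ℝ) : ℝ :=
  (∑ ω, f ω) / (Fintype.card Ω : ℝ)

/-- The joint cumulant `C{ξ_i}_{i ∈ A}` of the random variables `ξ_i`, `i ∈ A`:
`∑_σ (-1)^(#σ - 1) (#σ - 1)! ∏_{B ∈ σ} E ∏_{i ∈ B} ξ_i`, the sum being over all
partitions `σ` of `A`. -/
def jointCumulant {Ω ι : Type*} [Fintype Ω] [DecidableEq ι] (A : Finset ι) (ξ : ι → Ω → ℝ) : ℝ :=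
  ∑ σ : Finpartition A,
    (-1 : ℝ) ^ (σ.parts.card - 1) * ((σ.parts.card - 1)! : ℝ) *
      ∏ B ∈ σ.parts, uniformExpect (fun ω => ∏ i ∈ B, ξ i ω)

/-- The standardized ranks `Z_i = √(12 / (n² - 1)) (Q_i - (n + 1) / 2)`, where
`Q_i = ω(i) ∈ {1, …, n}` and `ω` is a uniformly distributed permutation. Since `Fin n` is
`{0, …, n - 1}`, the rank `Q_i` is the underlying natural number of `ω i` plus one. -/
def Z (n : ℕ) (i : Fin n) (ω : Equiv.Perm (Fin n)) : ℝ :=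
  Real.sqrt (12 / ((n : ℝ) ^ 2 - 1)) * ((((ω i : ℕ) : ℝ) + 1) - ((n : ℝ) + 1) / 2)

/-- Partitions of `{1, …, N}` are represented by the equivalence relations on `Fin N`, with the
lattice structure of `Setoid` (`π ≤ σ` means that `π` refines `σ`). This is the set of blocks. -/
def blocks {N : ℕ} (π : Setoid (Fin N)) : Finset (Finset (Fin N)) :=
  letI : DecidableRel π.r := Classical.decRel _
  (Finpartition.ofSetoid π).parts

/-- The number of blocks of a partition. -/
def numBlocks {N : ℕ} (π : Setoid (Fin N)) : ℕ := (blocks π).card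

/-- Every block has even cardinality. -/
def IsEvenPartition {N : ℕ} (π : Setoid (Fin N)) : Prop := ∀ A ∈ blocks π, Even A.card

/-- `n_γ(π)`: the number of blocks of cardinality `2γ`. -/
def numBlocksOfHalfSize {N : ℕ} (π : Setoid (Fin N)) (γ : ℕ) : ℕ :=
  ((blocks π).filter (fun A => A.card = 2 * γ)).card

/-- The `(n, N)`-words (elements of `{1, …, n}^N`) that are constant on each block of `π`. -/
def measurableWords {N : ℕ} (π : Setoid (Fin N)) (n : ℕ) : Finset (Fin N → Fin n) :=
  letI : DecidablePred (fun j : Fin N → Fin n => ∀ a b, π a b → j a = j b) := Classical.decPred _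
  Finset.univ.filter (fun j => ∀ a b, π a b → j a = j b)

/-- `C_π(j) = ∏_{A ∈ π} C{Z_{j_α}}_{α ∈ A}`. -/
def cumulantProduct {N n : ℕ} (π : Setoid (Fin N)) (j : Fin N → Fin n) : ℝ :=
  ∏ A ∈ blocks π, jointCumulant A (fun a => Z n (j a))

/-- Cut `2(k_1 + ⋯ + k_r)` consecutive positions into consecutive segments of lengths
`2k_1, …, 2k_r`: the segment of a position and its (zero-based) place in that segment. -/
def segmentEquiv {r : ℕ} (κ : Fin r → ℕ) : Fin (2 * ∑ i, κ i) ≃ (Σ i : Fin r, Fin (2 * κ i)) :=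
  (finCongr (Finset.mul_sum Finset.univ κ 2)).trans finSigmaFinEquiv.symm

/-- The place with zero-based number `x` in the segment `i` is labelled by `i` and by
`⌊(x + 1) / 2⌋` modulo `k_i`: so `2l - 1` and `2l` have the same label for `0 < l < k_i`, and so
have `2k_i - 1` and `0`, and there are no other coincidences. -/
def pairLabel {r : ℕ} (κ : Fin r → ℕ) (p : Σ i : Fin r, Fin (2 * κ i)) : Fin r × ℕ :=
  (p.1, ((p.2 : ℕ) + 1) / 2 % κ p.1)

/-- The perfect matching `π_1` attached to `k_1, …, k_r`. In a segment of length `2m`, whose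
positions are numbered `1, …, 2m`, its blocks are `{2, 3}, {4, 5}, …, {2m - 2, 2m - 1}, {2m, 1}`. -/
def pi1 {r : ℕ} (κ : Fin r → ℕ) : Setoid (Fin (2 * ∑ i, κ i)) :=
  Setoid.ker (fun a => pairLabel κ (segmentEquiv κ a))

end Spearman

end

/-! The extra exponent is nonnegative, so it is enough to prove the bound `O(n ^ #(σ ⊔ π))`; this
holds for arbitrary partitions `σ`, `π` of a fixed finite set.

The analytic input is `exists_cumulantBound`: a cumulant of bounded functions of coordinates of a
uniform permutation is `O(n ^ (1 - d))`, where `d` is the number of distinct coordinates. It is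
proved by induction on the number of variables, uniformly over all functions with a given bound. If
two variables share a coordinate, they are merged into their product; the cumulant changes by
products of smaller cumulants (`setCumulant_merge`). If all coordinates are distinct, one coordinate
is replaced by a position running over all `n` letters. The sum over positions is deterministic, and
only the positions already in use are exceptional. This gives a linear relation between moments
(`permMoment_relation`), which passes to cumulants (`setCumulant_relation`) and gains a factor `1 /
n`.

The combinatorial input is that a graph has at most as many vertices as components plus edges. For
the incidence graph between the letters of a `σ`-measurable word `j` and the blocks of `π`, this
reads `#letters + #π ≤ #(σ ⊔ π) + ∑ A, #j(A)`. Multiplying the cumulant bounds over the blocks then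
gives `|C_π(j)| = O(n ^ (#(σ ⊔ π) - #letters))`. As there are `O(n ^ m)` words with `m` letters, the
sum over words is `O(n ^ #(σ ⊔ π))`. -/

namespace Spearman

/-! ### Moments and cumulants as set functions: recursion, merging, linear relations. -/

section SetCumulant

variable {ι : Type*} [DecidableEq ι]

/-- The partitions of `A`, as sets of blocks. -/
def partitionsOf (A : Finset ι) : Finset (Finset (Finset ι)) :=
  (Finset.univ : Finset (Finpartition A)).image Finpartition.parts

theorem mem_partitionsOf {A : Finset ι} {P : Finset (Finset ι)} :
    P ∈ partitionsOf A ↔ (∀ C ∈ P, ∀ D ∈ P, ∀ x ∈ C, x ∈ D → C = D) ∧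
      (∀ x, x ∈ A ↔ ∃ C ∈ P, x ∈ C) ∧ ∅ ∉ P := by
  constructor
  · intro h
    obtain ⟨σ, -, rfl⟩ := Finset.mem_image.1 h
    refine ⟨fun C hC D hD x hx hx' => σ.disjoint.elim_finset hC hD x hx hx', fun x => ?_,
      σ.bot_notMem⟩
    conv_lhs => rw [← σ.sup_parts]
    simp
  · rintro ⟨h1, h2, h3⟩
    refine Finset.mem_image.2 ⟨⟨P, ?_, ?_, h3⟩, Finset.mem_univ _, rfl⟩
    · rw [Finset.supIndep_iff_pairwiseDisjoint]
      intro C hC D hD hCD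
      refine Finset.disjoint_left.2 fun x hx hx' => hCD (h1 C hC D hD x hx hx')
    · ext x
      rw [h2 x]
      simp

/-- The coefficient `(-1)^(c-1) (c-1)!` of partitions with `c` blocks. -/
noncomputable def moebiusWeight (c : ℕ) : ℝ := (-1 : ℝ) ^ (c - 1) * ((c - 1)! : ℝ)

/-- The cumulant attached to a set function `M` of moments. -/
noncomputable def setCumulant (M : Finset ι → ℝ) (A : Finset ι) : ℝ :=
  ∑ P ∈ partitionsOf A, moebiusWeight P.card * ∏ B ∈ P, M B

theorem jointCumulant_eq_setCumulant {Ω : Type*} [Fintype Ω] (A : Finset ι) (ξ : ι → Ω → ℝ) :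
    jointCumulant A ξ =
      setCumulant (fun B => uniformExpect (fun ω => ∏ i ∈ B, ξ i ω)) A := by
  unfold jointCumulant setCumulant partitionsOf
  rw [Finset.sum_image]
  · rfl
  · intro σ _ τ _ h
    exact Finpartition.ext h

theorem moebiusWeight_add (c : ℕ) (hc : 1 ≤ c) :
    moebiusWeight c + ((c - 1 : ℕ) : ℝ) * moebiusWeight (c - 1) = if c = 1 then 1 else 0 := by
  obtain ⟨m, rfl⟩ := Nat.exists_eq_add_of_le hc
  rcases m with _ | m
  · simp [moebiusWeight]
  · have h1 : 1 + (m + 1) - 1 = m + 1 := by omega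
    have h2 : m + 1 - 1 = m := by omega
    simp only [moebiusWeight, h1, h2]
    rw [if_neg (by omega), Nat.factorial_succ]
    push_cast
    ring

/-- Adjoining the block `B \ S` to a partition of `insert a S` gives a partition of `insert a B`
with a marked block avoiding `a`; removing the marked block is the inverse. -/
theorem sum_ssubsets_partitionsOf (M : Finset ι → ℝ) {a : ι} {B : Finset ι} (ha : a ∉ B) :
    ∑ S ∈ B.ssubsets, ∑ P ∈ partitionsOf (insert a S),
        moebiusWeight P.card * (∏ C ∈ P, M C) * M (B \ S) =
      ∑ R ∈ partitionsOf (insert a B), ∑ _C ∈ R.filter (fun C => a ∉ C),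
        moebiusWeight (R.card - 1) * ∏ D ∈ R, M D := by
  rw [Finset.sum_sigma', Finset.sum_sigma']
  have key : ∀ S P, S ⊂ B → P ∈ partitionsOf (insert a S) → B \ S ∉ P := by
    intro S P hS hP hmem
    obtain ⟨x, hx, hx'⟩ := Finset.exists_of_ssubset hS
    have := ((mem_partitionsOf.1 hP).2.1 x).2 ⟨_, hmem, by simp [hx, hx']⟩
    rcases Finset.mem_insert.1 this with rfl | h
    · exact ha hx
    · exact hx' h
  refine Finset.sum_bij' (fun p _ => ⟨insert (B \ p.1) p.2, B \ p.1⟩)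
    (fun q _ => ⟨B \ q.2, q.1.erase q.2⟩) ?_ ?_ ?_ ?_ ?_
  · rintro ⟨S, P⟩ h
    simp only [Finset.mem_sigma, Finset.mem_ssubsets, Finset.mem_filter] at h ⊢
    obtain ⟨hS, hP⟩ := h
    obtain ⟨h1, h2, h3⟩ := mem_partitionsOf.1 hP
    refine ⟨mem_partitionsOf.2 ⟨?_, ?_, ?_⟩, Finset.mem_insert_self _ _, by simp [ha]⟩
    · have hd : ∀ C ∈ P, ∀ x ∈ C, x ∉ B \ S := by
        intro C hC x hx hx'
        have := (h2 x).2 ⟨C, hC, hx⟩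
        simp only [Finset.mem_sdiff, Finset.mem_insert] at hx' this
        rcases this with rfl | h
        · exact ha hx'.1
        · exact hx'.2 h
      intro C hC D hD x hx hx'
      rcases Finset.mem_insert.1 hC with rfl | hC <;> rcases Finset.mem_insert.1 hD with rfl | hD
      · rfl
      · exact absurd hx (hd D hD x hx')
      · exact absurd hx' (hd C hC x hx)
      · exact h1 C hC D hD x hx hx'
    · intro x
      have := h2 x
      have hsub := @hS.1 x
      have hex : (∃ C ∈ insert (B \ S) P, x ∈ C) ↔ x ∈ B \ S ∨ ∃ C ∈ P, x ∈ C := by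
        simp only [Finset.mem_insert, or_and_right, exists_or, exists_eq_left]
      rw [hex, ← this]
      by_cases hxS : x ∈ S
      · simp [hxS, hsub hxS]
      · simp [hxS, or_comm]
    · rw [Finset.mem_insert, not_or]
      refine ⟨fun h => ?_, h3⟩
      exact hS.2 (Finset.sdiff_eq_empty_iff_subset.1 h.symm)
  · rintro ⟨R, C⟩ h
    simp only [Finset.mem_sigma, Finset.mem_ssubsets, Finset.mem_filter] at h ⊢
    obtain ⟨hR, hC, haC⟩ := h
    obtain ⟨h1, h2, h3⟩ := mem_partitionsOf.1 hR
    have hCB : C ⊆ B := fun x hx => by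
      rcases Finset.mem_insert.1 ((h2 x).2 ⟨C, hC, hx⟩) with rfl | h
      · exact absurd hx haC
      · exact h
    have hne : C.Nonempty := Finset.nonempty_iff_ne_empty.2 fun h => h3 (h ▸ hC)
    refine ⟨Finset.sdiff_ssubset hCB hne, mem_partitionsOf.2 ⟨?_, ?_, ?_⟩⟩
    · exact fun D hD E hE x hx hx' =>
        h1 D (Finset.mem_of_mem_erase hD) E (Finset.mem_of_mem_erase hE) x hx hx'
    · intro x
      constructor
      · intro hx
        have hxC : x ∉ C := by
          rcases Finset.mem_insert.1 hx with rfl | h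
          · exact haC
          · exact (Finset.mem_sdiff.1 h).2
        have hx2 : x ∈ insert a B := by
          rcases Finset.mem_insert.1 hx with rfl | h
          · simp
          · simp [(Finset.mem_sdiff.1 h).1]
        obtain ⟨D, hD, hxD⟩ := (h2 x).1 hx2
        exact ⟨D, Finset.mem_erase.2 ⟨fun h => hxC (h ▸ hxD), hD⟩, hxD⟩
      · rintro ⟨D, hD, hxD⟩
        obtain ⟨hDC, hD⟩ := Finset.mem_erase.1 hD
        have hxC : x ∉ C := fun hxC => hDC (h1 D hD C hC x hxD hxC)
        rcases Finset.mem_insert.1 ((h2 x).2 ⟨D, hD, hxD⟩) with rfl | h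
        · simp
        · simp [h, hxC]
    · exact fun h => h3 (Finset.mem_of_mem_erase h)
  · rintro ⟨S, P⟩ h
    simp only [Finset.mem_sigma, Finset.mem_ssubsets] at h
    simp [Finset.sdiff_sdiff_eq_self h.1.1, Finset.erase_insert (key S P h.1 h.2)]
  · rintro ⟨R, C⟩ h
    simp only [Finset.mem_sigma, Finset.mem_filter] at h
    obtain ⟨hR, hC, haC⟩ := h
    have hCB : C ⊆ B := fun x hx => by
      rcases Finset.mem_insert.1 (((mem_partitionsOf.1 hR).2.1 x).2 ⟨C, hC, hx⟩) with rfl | h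
      · exact absurd hx haC
      · exact h
    simp [Finset.sdiff_sdiff_eq_self hCB, Finset.insert_erase hC]
  · rintro ⟨S, P⟩ h
    simp only [Finset.mem_sigma, Finset.mem_ssubsets] at h
    have hk := key S P h.1 h.2
    simp only [Finset.card_insert_of_notMem hk, Finset.prod_insert hk, Nat.add_sub_cancel]
    ring

/-- The recursion relating moments and cumulants. -/
theorem sum_setCumulant_mul {M : Finset ι → ℝ} (hM : M ∅ = 1) {a : ι} {B : Finset ι}
    (ha : a ∉ B) :
    ∑ S ∈ B.powerset, setCumulant M (insert a S) * M (B \ S) = M (insert a B) := by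
  have hsplit : B.powerset = insert B B.ssubsets := by
    rw [Finset.ssubsets, Finset.insert_erase (Finset.mem_powerset_self B)]
  rw [hsplit, Finset.sum_insert (by simp [Finset.mem_ssubsets]), Finset.sdiff_self, hM, mul_one]
  have h1 : ∑ S ∈ B.ssubsets, setCumulant M (insert a S) * M (B \ S) =
      ∑ R ∈ partitionsOf (insert a B), ∑ _C ∈ R.filter (fun C => a ∉ C),
        moebiusWeight (R.card - 1) * ∏ D ∈ R, M D := by
    rw [← sum_ssubsets_partitionsOf M ha]
    exact Finset.sum_congr rfl fun S _ => Finset.sum_mul _ _ _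
  rw [h1, setCumulant, ← Finset.sum_add_distrib]
  -- A partition `R` is counted once for itself and once for each of its `#R - 1` blocks avoiding
  -- `a`; the weights cancel unless `R` has a single block.
  have h2 : ∀ R ∈ partitionsOf (insert a B),
      (moebiusWeight R.card * ∏ D ∈ R, M D) + ∑ _C ∈ R.filter (fun C => a ∉ C),
        moebiusWeight (R.card - 1) * ∏ D ∈ R, M D =
      if R = {insert a B} then M (insert a B) else 0 := by
    intro R hR
    obtain ⟨h1, h2, h3⟩ := mem_partitionsOf.1 hR
    obtain ⟨C, hC, haC⟩ := (h2 a).1 (by simp)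
    have hf : R.filter (fun C => a ∉ C) = R.erase C := by
      ext D
      simp only [Finset.mem_filter, Finset.mem_erase]
      constructor
      · rintro ⟨hD, haD⟩
        exact ⟨fun h => haD (h ▸ haC), hD⟩
      · rintro ⟨hne, hD⟩
        exact ⟨hD, fun haD => hne (h1 D hD C hC a haD haC)⟩
    have hcard : 1 ≤ R.card := Finset.card_pos.2 ⟨C, hC⟩
    rw [hf, Finset.sum_const, Finset.card_erase_of_mem hC, nsmul_eq_mul, ← mul_assoc, ← add_mul,
      moebiusWeight_add _ hcard]
    by_cases hc : R.card = 1
    · obtain ⟨D, rfl⟩ := Finset.card_eq_one.1 hc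
      have hD : D = insert a B := by
        ext x
        rw [h2 x]
        simp
      simp [hD]
    · rw [if_neg hc, if_neg (fun h => hc (by simp [h])), zero_mul]
  rw [Finset.sum_congr rfl h2, Finset.sum_ite_eq', if_pos]
  refine mem_partitionsOf.2 ⟨by simp, by simp, ?_⟩
  simp only [Finset.mem_singleton]
  exact fun h => Finset.insert_ne_empty a B h.symm

/-- Subset convolution with `M` is unitriangular because `M ∅ = 1`, hence injective. Cumulant
identities can therefore be checked after convolution, where cumulants turn back into moments. -/
theorem eq_of_sum_powerset_mul_eq {f g M : Finset ι → ℝ} (hM : M ∅ = 1) {B : Finset ι}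
    (h : ∀ U ⊆ B, ∑ S ∈ U.powerset, f S * M (U \ S) = ∑ S ∈ U.powerset, g S * M (U \ S)) :
    f B = g B := by
  suffices H : ∀ U, U ⊆ B → f U = g U from H B subset_rfl
  intro U
  induction U using Finset.strongInduction with
  | H U ih =>
    intro hU
    have hsplit : U.powerset = insert U U.ssubsets := by
      rw [Finset.ssubsets, Finset.insert_erase (Finset.mem_powerset_self U)]
    have := h U hU
    rw [hsplit, Finset.sum_insert (by simp [Finset.mem_ssubsets]),
      Finset.sum_insert (by simp [Finset.mem_ssubsets]), Finset.sdiff_self, hM] at this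
    have h2 : ∑ S ∈ U.ssubsets, f S * M (U \ S) = ∑ S ∈ U.ssubsets, g S * M (U \ S) := by
      refine Finset.sum_congr rfl fun S hS => ?_
      have hS := Finset.mem_ssubsets.1 hS
      rw [ih S hS (hS.1.trans hU)]
    linarith

/-- Both sides run over the ordered splittings of `B` into three parts. -/
theorem sum_powerset_mul_assoc (f g h : Finset ι → ℝ) (B : Finset ι) :
    ∑ S ∈ B.powerset, f S * ∑ T ∈ (B \ S).powerset, g T * h ((B \ S) \ T) =
      ∑ U ∈ B.powerset, (∑ S ∈ U.powerset, f S * g (U \ S)) * h (B \ U) := by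
  simp only [Finset.mul_sum, Finset.sum_mul]
  rw [Finset.sum_sigma', Finset.sum_sigma']
  refine Finset.sum_bij' (fun p _ => ⟨p.1 ∪ p.2, p.1⟩) (fun q _ => ⟨q.2, q.1 \ q.2⟩) ?_ ?_ ?_ ?_ ?_
  · rintro ⟨S, T⟩ h
    simp only [Finset.mem_sigma, Finset.mem_powerset] at h ⊢
    exact ⟨Finset.union_subset h.1 (h.2.trans Finset.sdiff_subset), Finset.subset_union_left⟩
  · rintro ⟨U, S⟩ h
    simp only [Finset.mem_sigma, Finset.mem_powerset] at h ⊢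
    exact ⟨h.2.trans h.1, Finset.sdiff_subset_sdiff h.1 subset_rfl⟩
  · rintro ⟨S, T⟩ h
    simp only [Finset.mem_sigma, Finset.mem_powerset] at h
    have hd : Disjoint T S := Finset.disjoint_of_subset_left h.2 Finset.sdiff_disjoint
    simp [Finset.union_sdiff_cancel_left hd.symm]
  · rintro ⟨U, S⟩ h
    simp only [Finset.mem_sigma, Finset.mem_powerset] at h
    simp [Finset.union_sdiff_of_subset h.2]
  · rintro ⟨S, T⟩ h
    simp only [Finset.mem_sigma, Finset.mem_powerset] at h
    have hd : Disjoint T S := Finset.disjoint_of_subset_left h.2 Finset.sdiff_disjoint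
    simp only [Finset.union_sdiff_cancel_left hd.symm, sdiff_sdiff_left, Finset.sup_eq_union]
    ring

/-- The cumulant of a family in which two variables `a`, `b` are replaced by their product
(which is labelled `b`). -/
theorem setCumulant_merge {M M' : Finset ι → ℝ} (hM : M ∅ = 1) {a b : ι} {B : Finset ι}
    (hab : a ≠ b) (ha : a ∉ B) (hb : b ∉ B) (h1 : ∀ S ⊆ B, M' S = M S)
    (h2 : ∀ S ⊆ B, M' (insert b S) = M (insert a (insert b S))) :
    setCumulant M' (insert b B) = setCumulant M (insert a (insert b B)) +
      ∑ S ∈ B.powerset, setCumulant M (insert a S) * setCumulant M (insert b (B \ S)) := by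
  -- After convolution with `M`, both sides become the moment of `insert a (insert b U)`.
  refine eq_of_sum_powerset_mul_eq (f := fun U => setCumulant M' (insert b U))
    (g := fun U => setCumulant M (insert a (insert b U)) +
      ∑ S ∈ U.powerset, setCumulant M (insert a S) * setCumulant M (insert b (U \ S))) hM ?_
  intro U hU
  have haU : a ∉ U := fun h => ha (hU h)
  have hbU : b ∉ U := fun h => hb (hU h)
  have hM' : M' ∅ = 1 := by rw [h1 ∅ (by simp), hM]
  have e1 : ∑ S ∈ U.powerset, setCumulant M' (insert b S) * M (U \ S) =
      M (insert a (insert b U)) := by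
    rw [← h2 U hU, ← sum_setCumulant_mul hM' hbU]
    refine Finset.sum_congr rfl fun S hS => ?_
    rw [h1 (U \ S) (Finset.sdiff_subset.trans hU)]
  have e2 := sum_setCumulant_mul hM (a := a) (B := insert b U)
    (by simp only [Finset.mem_insert, not_or]; exact ⟨hab, haU⟩)
  -- The sets not containing `b` produce the products of two cumulants, those containing `b` the
  -- joint cumulant.
  rw [Finset.sum_powerset_insert hbU] at e2
  have e3 : ∑ S ∈ U.powerset, setCumulant M (insert a S) * M (insert b U \ S) =
      ∑ S ∈ U.powerset, (∑ T ∈ S.powerset, setCumulant M (insert a T) *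
        setCumulant M (insert b (S \ T))) * M (U \ S) := by
    rw [← sum_powerset_mul_assoc (fun S => setCumulant M (insert a S))
      (fun S => setCumulant M (insert b S)) M U]
    refine Finset.sum_congr rfl fun S hS => ?_
    have hS := Finset.mem_powerset.1 hS
    rw [Finset.insert_sdiff_of_notMem _ (fun h => hbU (hS h)),
      sum_setCumulant_mul hM (a := b) (B := U \ S) (by simp [hbU])]
  have e4 : ∑ S ∈ U.powerset, setCumulant M (insert a (insert b S)) * M (insert b U \ insert b S) =
      ∑ S ∈ U.powerset, setCumulant M (insert a (insert b S)) * M (U \ S) := by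
    refine Finset.sum_congr rfl fun S hS => ?_
    have : insert b U \ insert b S = U \ S := by
      ext x
      simp only [Finset.mem_sdiff, Finset.mem_insert]
      by_cases hx : x = b
      · subst hx; simp [hbU]
      · simp [hx]
    rw [this]
  rw [e3, e4] at e2
  rw [e1, ← e2]
  simp only [add_mul, Finset.sum_add_distrib]
  ring

/-- A linear relation between moments of the form produced by resampling one variable passes to
cumulants. -/
theorem setCumulant_relation {M : Finset ι → ℝ} (hM : M ∅ = 1) {i : ι} {B : Finset ι}
    (hi : i ∉ B) (P N : ι → Finset ι → ℝ) (n c : ℝ)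
    (hP : ∀ α ∈ B, ∀ S ⊆ B.erase α, P α S = M S) (hN : ∀ α ∈ B, ∀ S ⊆ B.erase α, N α S = M S)
    (h : ∀ U ⊆ B, n * (M (insert i U) - c * M U) = ∑ α ∈ U, (P α U - N α U)) :
    n * (setCumulant M (insert i B) - if B = ∅ then c else 0) =
      ∑ α ∈ B, (setCumulant (P α) B - setCumulant (N α) B) := by
  refine eq_of_sum_powerset_mul_eq
    (f := fun U => n * (setCumulant M (insert i U) - if U = ∅ then c else 0))
    (g := fun U => ∑ α ∈ U, (setCumulant (P α) U - setCumulant (N α) U)) hM ?_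
  intro U hU
  have e1 : ∑ S ∈ U.powerset, n * (setCumulant M (insert i S) - if S = ∅ then c else 0) *
      M (U \ S) = n * (M (insert i U) - c * M U) := by
    rw [← sum_setCumulant_mul hM (fun hh => hi (hU hh))]
    have : ∑ S ∈ U.powerset, (if S = ∅ then c else 0) * M (U \ S) = c * M U := by
      rw [Finset.sum_eq_single ∅]
      · simp
      · intro S _ hS
        simp [hS]
      · simp
    rw [← this, ← Finset.sum_sub_distrib, Finset.mul_sum]
    refine Finset.sum_congr rfl fun S _ => by ring
  have e2 : ∀ (D : ι → Finset ι → ℝ), (∀ α ∈ B, ∀ S ⊆ B.erase α, D α S = M S) →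
      ∑ S ∈ U.powerset, (∑ α ∈ S, setCumulant (D α) S) * M (U \ S) = ∑ α ∈ U, D α U := by
    intro D hD
    simp only [Finset.sum_mul]
    -- For fixed `α ∈ S`, the complement `U \ S` misses `α`, so there `M` may be replaced by `D α`;
    -- the sum over `S` is then the moment-cumulant recursion of `D α`.
    rw [Finset.sum_comm' (t' := U) (s' := fun α => U.powerset.filter (fun S => α ∈ S))]
    · refine Finset.sum_congr rfl fun α hα => ?_
      have hαB := hU hα
      have hD0 : D α ∅ = 1 := by rw [hD α hαB ∅ (by simp), hM]
      have hna : α ∉ U.erase α := by simp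
      have := sum_setCumulant_mul hD0 hna
      rw [Finset.insert_erase hα] at this
      rw [← this]
      refine Finset.sum_bij' (fun S _ => S.erase α) (fun S _ => insert α S) ?_ ?_ ?_ ?_ ?_
      · intro S hS
        simp only [Finset.mem_filter, Finset.mem_powerset] at hS ⊢
        exact Finset.erase_subset_erase _ hS.1
      · intro S hS
        simp only [Finset.mem_filter, Finset.mem_powerset] at hS ⊢
        exact ⟨Finset.insert_subset hα (hS.trans (Finset.erase_subset _ _)), by simp⟩
      · intro S hS
        simp only [Finset.mem_filter, Finset.mem_powerset] at hS
        exact Finset.insert_erase hS.2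
      · intro S hS
        simp only [Finset.mem_powerset] at hS
        exact Finset.erase_insert (fun hh => by simpa using hS hh)
      · intro S hS
        simp only [Finset.mem_filter, Finset.mem_powerset] at hS
        have he : U.erase α \ S.erase α = U \ S := by
          ext x
          simp only [Finset.mem_sdiff, Finset.mem_erase]
          by_cases hx : x = α
          · subst hx; simp [hS.2]
          · simp [hx]
        rw [Finset.insert_erase hS.2, he, hD α hαB (U \ S)]
        intro x hx
        obtain ⟨hx1, hx2⟩ := Finset.mem_sdiff.1 hx
        exact Finset.mem_erase.2 ⟨fun hh => hx2 (hh ▸ hS.2), hU hx1⟩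
    · intro S α
      simp only [Finset.mem_powerset, Finset.mem_filter]
      constructor
      · rintro ⟨h1, h2⟩
        exact ⟨⟨h1, h2⟩, h1 h2⟩
      · rintro ⟨h1, h2⟩
        exact h1
  rw [e1, h U hU]
  simp only [Finset.sum_sub_distrib, sub_mul]
  rw [e2 P hP, e2 N hN]

end SetCumulant

/-! ### Decay of cumulants of functions of a uniform permutation. -/

section PermutationCumulants

theorem abs_uniformExpect_le {Ω : Type*} [Fintype Ω] [Nonempty Ω] {f : Ω → ℝ} {K : ℝ}
    (h : ∀ ω, |f ω| ≤ K) : |uniformExpect f| ≤ K := by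
  have hc : (0 : ℝ) < Fintype.card Ω := by exact_mod_cast Fintype.card_pos
  rw [uniformExpect, abs_div, abs_of_pos hc, div_le_iff₀ hc]
  calc |∑ ω, f ω| ≤ ∑ ω, |f ω| := Finset.abs_sum_le_sum_abs _ _
    _ ≤ ∑ _ω : Ω, K := Finset.sum_le_sum fun ω _ => h ω
    _ = K * Fintype.card Ω := by simp [mul_comm]

variable {ι : Type*}

/-- The mixed moments of the variables `g_α(ω(j_α))`, for a uniformly distributed permutation
`ω`. -/
noncomputable def permMoment {n : ℕ} (j : ι → Fin n) (g : ι → Fin n → ℝ) (B : Finset ι) : ℝ :=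
  uniformExpect (fun ω : Equiv.Perm (Fin n) => ∏ α ∈ B, g α (ω (j α)))

theorem permMoment_empty {n : ℕ} (j : ι → Fin n) (g : ι → Fin n → ℝ) : permMoment j g ∅ = 1 := by
  have : (n ! : ℝ) ≠ 0 := by positivity
  simp [permMoment, uniformExpect, Fintype.card_perm, this]

variable [DecidableEq ι]

theorem permMoment_update_of_notMem {n : ℕ} (j : ι → Fin n) (g : ι → Fin n → ℝ) {a : ι}
    (f : Fin n → ℝ) {S : Finset ι} (h : a ∉ S) :
    permMoment j (Function.update g a f) S = permMoment j g S := by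
  unfold permMoment
  congr 1
  ext ω
  refine Finset.prod_congr rfl fun α hα => ?_
  have hαa : α ≠ a := by
    rintro rfl
    exact h hα
  rw [Function.update_of_ne hαa]

/-- Composition with the transposition of `a` and `b` preserves the uniform law. -/
theorem uniformExpect_perm_eq {n : ℕ} {f : Fin n → ℝ} {G : Equiv.Perm (Fin n) → ℝ} (a b : Fin n)
    (hG : ∀ ω, G (ω * Equiv.swap a b) = G ω) :
    uniformExpect (fun ω : Equiv.Perm (Fin n) => f (ω a) * G ω) =
      uniformExpect (fun ω : Equiv.Perm (Fin n) => f (ω b) * G ω) := by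
  unfold uniformExpect
  congr 1
  rw [← Equiv.sum_comp (Equiv.mulRight (Equiv.swap a b))]
  refine Finset.sum_congr rfl fun ω _ => ?_
  simp [hG]

theorem uniformExpect_sum {Ω κ : Type*} [Fintype Ω] (s : Finset κ) (f : κ → Ω → ℝ) :
    uniformExpect (fun ω => ∑ l ∈ s, f l ω) = ∑ l ∈ s, uniformExpect (f l) := by
  unfold uniformExpect
  rw [Finset.sum_comm, Finset.sum_div]

/-- Resampling the variable with label `i`. -/
theorem permMoment_relation {n : ℕ} (j : ι → Fin n) (g : ι → Fin n → ℝ) {i : ι} {U : Finset ι}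
    (hi : i ∉ U) (hj : Set.InjOn j (insert i U : Finset ι)) :
    (n : ℝ) * (permMoment j g (insert i U) - (∑ x, g i x) / n * permMoment j g U) =
      ∑ α ∈ U, (permMoment j g (insert i U) -
        permMoment j (Function.update g α (g i * g α)) U) := by
  set G : Equiv.Perm (Fin n) → ℝ := fun ω => ∏ α ∈ U, g α (ω (j α)) with hG
  have hn : (n : ℝ) ≠ 0 := by
    have := (j i).pos
    positivity
  have e1 : permMoment j g (insert i U) =
      uniformExpect (fun ω : Equiv.Perm (Fin n) => g i (ω (j i)) * G ω) := by
    unfold permMoment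
    congr 1
    ext ω
    rw [Finset.prod_insert hi]
  have e2 : ∀ α ∈ U, permMoment j (Function.update g α (g i * g α)) U =
      uniformExpect (fun ω : Equiv.Perm (Fin n) => g i (ω (j α)) * G ω) := by
    intro α hα
    unfold permMoment
    congr 1
    ext ω
    rw [hG]
    simp only
    rw [← Finset.mul_prod_erase U _ hα, ← Finset.mul_prod_erase U (fun α => g α (ω (j α))) hα,
      Function.update_self, Pi.mul_apply, mul_assoc]
    congr 2
    refine Finset.prod_congr rfl fun β hβ => ?_
    rw [Function.update_of_ne (Finset.ne_of_mem_erase hβ)]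
  -- The sum of `g i (ω l)` over all positions `l` does not depend on `ω`.
  have e3 : ∑ l : Fin n, uniformExpect (fun ω : Equiv.Perm (Fin n) => g i (ω l) * G ω) =
      (∑ x, g i x) * permMoment j g U := by
    rw [← uniformExpect_sum]
    unfold permMoment uniformExpect
    rw [← mul_div_assoc, Finset.mul_sum]
    congr 1
    refine Finset.sum_congr rfl fun ω _ => ?_
    change ∑ l, g i (ω l) * G ω = _
    rw [← Finset.sum_mul, Equiv.sum_comp ω (g i)]
  have hjU : Set.InjOn j U := hj.mono (by simp)
  have e4 : ∑ l : Fin n, uniformExpect (fun ω : Equiv.Perm (Fin n) => g i (ω l) * G ω) =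
      ∑ α ∈ U, permMoment j (Function.update g α (g i * g α)) U +
        ((n : ℝ) - U.card) * permMoment j g (insert i U) := by
    rw [← Finset.sum_add_sum_compl (U.image j), Finset.sum_image hjU, Finset.sum_congr rfl e2]
    congr 1
    -- A position outside `j(U)` can be exchanged with `j i` without moving any coordinate used in
    -- `G`.
    have : ∀ l ∈ (U.image j)ᶜ, uniformExpect (fun ω : Equiv.Perm (Fin n) => g i (ω l) * G ω) =
        permMoment j g (insert i U) := by
      intro l hl
      rw [e1]
      refine uniformExpect_perm_eq _ _ fun ω => ?_
      refine Finset.prod_congr rfl fun β hβ => ?_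
      have h1 : j β ≠ l := by
        rintro rfl
        simp only [Finset.mem_compl, Finset.mem_image, not_exists, not_and] at hl
        exact hl β hβ rfl
      have h2 : j β ≠ j i := by
        intro h
        have := hj (by simp [hβ]) (by simp) h
        exact hi (this ▸ hβ)
      rw [Equiv.Perm.mul_apply, Equiv.swap_apply_of_ne_of_ne h1 h2]
    rw [Finset.sum_congr rfl this, Finset.sum_const, Finset.card_compl,
      Finset.card_image_of_injOn hjU, Fintype.card_fin, nsmul_eq_mul, Nat.cast_sub]
    calc U.card = (U.image j).card := (Finset.card_image_of_injOn hjU).symm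
      _ ≤ n := by simpa using Finset.card_le_univ (U.image j)
  rw [Finset.sum_sub_distrib, Finset.sum_const, nsmul_eq_mul]
  rw [e4] at e3
  field_simp
  linarith

/-- Merging two variables with the same index. -/
theorem setCumulant_permMoment_merge {n : ℕ} (j : ι → Fin n) (g : ι → Fin n → ℝ) {a b : ι}
    {B : Finset ι} (hab : a ≠ b) (ha : a ∉ B) (hb : b ∉ B) (hj : j a = j b) :
    setCumulant (permMoment j g) (insert a (insert b B)) =
      setCumulant (permMoment j (Function.update g b (g a * g b))) (insert b B) -
      ∑ S ∈ B.powerset, setCumulant (permMoment j g) (insert a S) *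
        setCumulant (permMoment j g) (insert b (B \ S)) := by
  rw [eq_sub_iff_add_eq]
  refine (setCumulant_merge (permMoment_empty j g) hab ha hb (fun S hS => ?_) fun S hS => ?_).symm
  · exact permMoment_update_of_notMem _ _ _ fun h => hb (hS h)
  · have hbS : b ∉ S := fun h => hb (hS h)
    have haS : a ∉ insert b S := by
      simp only [Finset.mem_insert, not_or]
      exact ⟨hab, fun h => ha (hS h)⟩
    unfold permMoment
    congr 1
    ext ω
    rw [Finset.prod_insert hbS, Finset.prod_insert haS, Finset.prod_insert hbS,
      Function.update_self, Pi.mul_apply, mul_assoc, hj]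
    congr 2
    refine Finset.prod_congr rfl fun β hβ => ?_
    have hβb : β ≠ b := by
      rintro rfl
      exact hbS hβ
    rw [Function.update_of_ne hβb]

/-- The recursion for cumulants of functions of distinct coordinates of a uniform permutation. -/
theorem setCumulant_permMoment_relation {n : ℕ} (j : ι → Fin n) (g : ι → Fin n → ℝ) {i : ι}
    {U : Finset ι} (hi : i ∉ U) (hj : Set.InjOn j (insert i U : Finset ι)) :
    (n : ℝ) * (setCumulant (permMoment j g) (insert i U) -
        if U = ∅ then (∑ x, g i x) / n else 0) =
      ∑ α ∈ U, (setCumulant (permMoment j g) (insert i U) +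
        ∑ S ∈ (U.erase α).powerset, setCumulant (permMoment j g) (insert i S) *
          setCumulant (permMoment j g) (insert α (U.erase α \ S)) -
        setCumulant (permMoment j (Function.update g α (g i * g α))) U) := by
  -- The first family replaces variable `α` by its product with variable `i` (still at its own
  -- coordinate `j i`), so its cumulants expand by merging. The second replaces `g α` by `g i * g α`
  -- at the coordinate `j α`.
  rw [setCumulant_relation (permMoment_empty j g) hi
    (fun α S => if α ∈ S then permMoment j g (insert i S) else permMoment j g S)
    (fun α => permMoment j (Function.update g α (g i * g α))) n ((∑ x, g i x) / n)]
  · refine Finset.sum_congr rfl fun α hα => ?_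
    congr 1
    have hia : i ≠ α := fun h => hi (h ▸ hα)
    have := setCumulant_merge (M' := fun S => if α ∈ S then permMoment j g (insert i S) else
      permMoment j g S) (permMoment_empty j g) (a := i) (b := α) (B := U.erase α) hia
      (fun h => hi (Finset.mem_of_mem_erase h)) (by simp)
      (fun S hS => if_neg fun h => by simpa using hS h) (fun S hS => if_pos (by simp))
    rwa [Finset.insert_erase hα] at this
  · intro α _ S hS
    exact if_neg fun h => by simpa using hS h
  · intro α _ S hS
    exact permMoment_update_of_notMem _ _ _ fun h => by simpa using hS h
  · intro V hV
    rw [permMoment_relation j g (fun h => hi (hV h))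
      (hj.mono (by exact_mod_cast Finset.insert_subset_insert _ hV))]
    refine Finset.sum_congr rfl fun α hα => ?_
    rw [if_pos hα]

/-- Factors of order `n ^ (1 - p)` and `n ^ (1 - q)` have a product of order `n ^ (2 - p - q)`,
which is at most `n ^ (1 - d)`. -/
theorem mul_pow_le_of_mul_pow_le {x y C n : ℝ} {p q d : ℕ} (hn : 1 ≤ n) (hC : 0 ≤ C)
    (hx : |x| * n ^ p ≤ C * n) (hy : |y| * n ^ q ≤ C * n) (hd : d + 1 ≤ p + q) :
    |x * y| * n ^ d ≤ C * C * n := by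
  have hn0 : 0 < n := by linarith
  have h1 : (|x| * n ^ p) * (|y| * n ^ q) ≤ (C * n) * (C * n) :=
    mul_le_mul hx hy (by positivity) (by positivity)
  have h2 : |x * y| * n ^ (d + 1) ≤ |x * y| * n ^ (p + q) := by gcongr
  rw [abs_mul] at h2 ⊢
  refine le_of_mul_le_mul_right ?_ hn0
  calc |x| * |y| * n ^ d * n = |x| * |y| * n ^ (d + 1) := by ring
    _ ≤ |x| * |y| * n ^ (p + q) := h2
    _ = (|x| * n ^ p) * (|y| * n ^ q) := by rw [pow_add]; ring
    _ ≤ (C * n) * (C * n) := h1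
    _ = C * C * n * n := by ring

/-- The cumulants of all nonempty sets of at most `m` variables are `≤ C n ^ (1 - d)`, when `d`
distinct coordinates are involved. -/
def CumulantBound {n : ℕ} (j : ι → Fin n) (g : ι → Fin n → ℝ) (m : ℕ) (C : ℝ) : Prop :=
  ∀ A : Finset ι, A.Nonempty → A.card ≤ m →
    |setCumulant (permMoment j g) A| * (n : ℝ) ^ (A.image j).card ≤ C * n

theorem CumulantBound.sum_le {n : ℕ} {j : ι → Fin n} {g : ι → Fin n → ℝ} {m : ℕ} {C : ℝ}
    (h : CumulantBound j g m C) (hn : (1 : ℝ) ≤ n) (hC : 0 ≤ C) {a b : ι} {B : Finset ι}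
    (hB : B.card + 1 ≤ m) {d : ℕ}
    (hd : ∀ S ⊆ B, d + 1 ≤ ((insert a S).image j).card + ((insert b (B \ S)).image j).card) :
    |∑ S ∈ B.powerset, setCumulant (permMoment j g) (insert a S) *
      setCumulant (permMoment j g) (insert b (B \ S))| * (n : ℝ) ^ d ≤ 2 ^ m * (C * C) * n := by
  have hprod : ∀ S ∈ B.powerset, |setCumulant (permMoment j g) (insert a S) *
      setCumulant (permMoment j g) (insert b (B \ S))| * (n : ℝ) ^ d ≤ C * C * n := by
    intro S hS
    have hS := Finset.mem_powerset.1 hS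
    refine mul_pow_le_of_mul_pow_le hn hC (h _ (by simp) ?_) (h _ (by simp) ?_) (hd S hS)
    · exact (Finset.card_insert_le _ _).trans (by have := Finset.card_le_card hS; omega)
    · exact (Finset.card_insert_le _ _).trans
        (by have := Finset.card_le_card (Finset.sdiff_subset (s := B) (t := S)); omega)
  calc _ ≤ (∑ S ∈ B.powerset, |setCumulant (permMoment j g) (insert a S) *
        setCumulant (permMoment j g) (insert b (B \ S))|) * (n : ℝ) ^ d := by
        gcongr
        exact Finset.abs_sum_le_sum_abs _ _
    _ = ∑ S ∈ B.powerset, |setCumulant (permMoment j g) (insert a S) *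
        setCumulant (permMoment j g) (insert b (B \ S))| * (n : ℝ) ^ d := Finset.sum_mul _ _ _
    _ ≤ ∑ _S ∈ B.powerset, C * C * n := Finset.sum_le_sum hprod
    _ = 2 ^ B.card * (C * C) * n := by
        rw [Finset.sum_const, Finset.card_powerset, nsmul_eq_mul]
        push_cast
        ring
    _ ≤ 2 ^ m * (C * C) * n := by
        have : (2 : ℝ) ^ B.card ≤ 2 ^ m := pow_le_pow_right₀ (by norm_num) (by omega)
        gcongr

theorem abs_setCumulant_singleton_le {n : ℕ} (j : ι → Fin n) {g : ι → Fin n → ℝ} {K : ℝ}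
    (hg : ∀ α x, |g α x| ≤ K) (i : ι) : |setCumulant (permMoment j g) {i}| ≤ K := by
  have h := sum_setCumulant_mul (permMoment_empty j g) (a := i) (B := ∅) (by simp)
  simp only [Finset.powerset_empty, Finset.sum_singleton, Finset.sdiff_self, permMoment_empty,
    mul_one, insert_empty_eq] at h
  rw [h]
  refine abs_uniformExpect_le fun ω => ?_
  simpa using hg i _

/-- In the recursion the unknown cumulant also occurs `#U` times on the right, so it is solved for
with coefficient `n - #U`. The remaining terms are of order `n ^ (1 - #U)`, and the division gains
the missing factor `1 / n`. -/
theorem CumulantBound.of_injOn {n : ℕ} {j : ι → Fin n} {g : ι → Fin n → ℝ} {m : ℕ} {C : ℝ}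
    (h : CumulantBound j g m C) (hn : (1 : ℝ) ≤ n) (hC : 0 ≤ C)
    (hup : ∀ a b, CumulantBound j (Function.update g b (g a * g b)) m C)
    {i : ι} {U : Finset ι} (hiU : i ∉ U) (hU : U.Nonempty) (hm : U.card ≤ m)
    (hj : Set.InjOn j (insert i U : Finset ι)) :
    |setCumulant (permMoment j g) (insert i U)| * (n : ℝ) ^ ((insert i U).image j).card ≤
      (m + 1) * (m * (2 ^ m * (C * C) + C)) * n := by
  have hrel := setCumulant_permMoment_relation j g hiU hj
  set κ := setCumulant (permMoment j g) (insert i U) with hκ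
  have hcard : ((insert i U).image j).card = U.card + 1 := by
    rw [Finset.card_image_of_injOn hj, Finset.card_insert_of_notMem hiU]
  rw [hcard]
  have hUn : U.card + 1 ≤ n := by
    rw [← hcard]
    simpa using Finset.card_le_univ ((insert i U).image j)
  rw [if_neg hU.ne_empty, sub_zero, Finset.sum_sub_distrib, Finset.sum_add_distrib,
    Finset.sum_const, nsmul_eq_mul] at hrel
  set s : ι → ℝ := fun α => ∑ S ∈ (U.erase α).powerset,
    setCumulant (permMoment j g) (insert i S) *
      setCumulant (permMoment j g) (insert α (U.erase α \ S)) with hs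
  set t : ι → ℝ := fun α =>
    setCumulant (permMoment j (Function.update g α (g i * g α))) U with ht
  set u := U.card with hu
  have hterm : ∀ α ∈ U, |s α - t α| * (n : ℝ) ^ u ≤ (2 ^ m * (C * C) + C) * n := by
    intro α hα
    have hcα := Finset.card_erase_add_one hα
    have hiα : i ∉ U.erase α := fun hh => hiU (Finset.mem_of_mem_erase hh)
    have h1 : |s α| * (n : ℝ) ^ u ≤ 2 ^ m * (C * C) * n := by
      refine h.sum_le hn hC (by omega) fun S hS => ?_
      have hSU : S ⊆ U := hS.trans (Finset.erase_subset _ _)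
      have hsub1 : insert i S ⊆ insert i U := Finset.insert_subset_insert _ hSU
      have hsub2 : insert α (U.erase α \ S) ⊆ insert i U :=
        (Finset.insert_subset hα (Finset.sdiff_subset.trans (Finset.erase_subset _ _))).trans
          (Finset.subset_insert _ _)
      rw [Finset.card_image_of_injOn (hj.mono (by exact_mod_cast hsub1)),
        Finset.card_image_of_injOn (hj.mono (by exact_mod_cast hsub2)),
        Finset.card_insert_of_notMem (fun hh => hiU (hSU hh)),
        Finset.card_insert_of_notMem (by simp), Finset.card_sdiff_of_subset hS]
      have := Finset.card_le_card hS
      omega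
    have h2 : |t α| * (n : ℝ) ^ u ≤ C * n := by
      have := hup i α U hU hm
      rwa [Finset.card_image_of_injOn (hj.mono (by simp))] at this
    calc |s α - t α| * (n : ℝ) ^ u ≤ (|s α| + |t α|) * (n : ℝ) ^ u := by
          gcongr
          exact abs_sub _ _
      _ ≤ _ := by
          rw [add_mul, add_mul]
          exact add_le_add h1 h2
  have hnu : ((n : ℝ) - u) * κ = ∑ α ∈ U, (s α - t α) := by
    rw [Finset.sum_sub_distrib]
    linarith
  have hun : (u : ℝ) + 1 ≤ n := by exact_mod_cast hUn
  have hum : (u : ℝ) ≤ m := by exact_mod_cast hm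
  have hpos : 0 < (n : ℝ) - u := by linarith
  obtain ⟨D, hD⟩ : ∃ D, D = 2 ^ m * (C * C) + C := ⟨_, rfl⟩
  have hD0 : 0 ≤ D := by rw [hD]; positivity
  rw [← hD] at hterm ⊢
  have hmain : ((n : ℝ) - u) * |κ| * (n : ℝ) ^ u ≤ u * (D * n) := by
    rw [← abs_of_pos hpos, ← abs_mul, hnu]
    calc _ ≤ (∑ α ∈ U, |s α - t α|) * (n : ℝ) ^ u := by
          gcongr
          exact Finset.abs_sum_le_sum_abs _ _
      _ ≤ ∑ α ∈ U, D * n := by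
          rw [Finset.sum_mul]
          exact Finset.sum_le_sum hterm
      _ = _ := by rw [Finset.sum_const, nsmul_eq_mul]
  -- The difference of the two sides is `u * (n - (u + 1))`; this makes division by `n - u` as good
  -- as division by `n`, up to the factor `u + 1`.
  have hn2 : (n : ℝ) ≤ (u + 1) * (n - u) := by
    have : (0 : ℝ) ≤ u * (n - (u + 1)) := mul_nonneg (by positivity) (by linarith)
    linarith
  calc |κ| * (n : ℝ) ^ (u + 1) = n * (|κ| * (n : ℝ) ^ u) := by ring
    _ ≤ (u + 1) * (n - u) * (|κ| * (n : ℝ) ^ u) := by gcongr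
    _ = (u + 1) * (((n : ℝ) - u) * |κ| * (n : ℝ) ^ u) := by ring
    _ ≤ (u + 1) * (u * (D * n)) := by gcongr
    _ ≤ (m + 1) * (m * (D * n)) := by gcongr
    _ = (m + 1) * (m * D) * n := by ring

/-- Merging `a` and `b` loses no coordinate. In each product term the two factors share the
coordinate `j a`, which supplies the extra unit in the exponent required by `CumulantBound.sum_le`.
-/
theorem CumulantBound.of_eq {n : ℕ} {j : ι → Fin n} {g : ι → Fin n → ℝ} {m : ℕ} {C : ℝ}
    (h : CumulantBound j g m C) (hn : (1 : ℝ) ≤ n) (hC : 0 ≤ C)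
    (hup : ∀ a b, CumulantBound j (Function.update g b (g a * g b)) m C)
    {a b : ι} {B : Finset ι} (hab : a ≠ b) (ha : a ∉ B) (hb : b ∉ B) (hm : B.card + 1 ≤ m)
    (hjab : j a = j b) :
    |setCumulant (permMoment j g) (insert a (insert b B))| *
        (n : ℝ) ^ ((insert a (insert b B)).image j).card ≤ (2 ^ m * (C * C) + C) * n := by
  have himg : (insert a (insert b B)).image j = (insert b B).image j := by
    rw [Finset.image_insert, hjab]
    exact Finset.insert_eq_self.2 (Finset.mem_image_of_mem j (by simp))
  have h1 := hup a b (insert b B) (by simp) (by rw [Finset.card_insert_of_notMem hb]; omega)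
  have h2 := h.sum_le hn hC (a := a) (b := b) hm (d := ((insert b B).image j).card) (by
    intro S hS
    have hun : (insert a S).image j ∪ (insert b (B \ S)).image j = (insert b B).image j := by
      rw [← Finset.image_union, ← himg]
      congr 1
      rw [Finset.insert_union, Finset.union_insert, Finset.union_sdiff_of_subset hS]
    rw [← hun, ← Finset.card_union_add_card_inter]
    refine Nat.add_le_add_left (Finset.card_pos.2 ⟨j a, Finset.mem_inter.2 ⟨?_, ?_⟩⟩) _
    · exact Finset.mem_image_of_mem j (by simp)
    · rw [hjab]
      exact Finset.mem_image_of_mem j (by simp))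
  rw [setCumulant_permMoment_merge j g hab ha hb hjab, himg]
  refine (mul_le_mul_of_nonneg_right (abs_sub _ _) (by positivity)).trans ?_
  rw [add_mul, add_mul, add_comm]
  exact add_le_add h2 h1

/-- Joint cumulants of bounded functions of coordinates of a uniform permutation of `n` letters
are `O(n ^ (1 - d))` when `d` distinct coordinates are involved. -/
theorem exists_cumulantBound (m : ℕ) : ∀ K : ℝ, 0 ≤ K → ∃ C : ℝ, 0 ≤ C ∧
    ∀ (n : ℕ) (j : ι → Fin n) (g : ι → Fin n → ℝ), (∀ α x, |g α x| ≤ K) →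
      CumulantBound j g m C := by
  induction m with
  | zero =>
    intro K _
    refine ⟨0, le_rfl, fun n j g _ A hA hm => ?_⟩
    simp only [Nat.le_zero, Finset.card_eq_zero] at hm
    exact absurd hm hA.ne_empty
  | succ m ih =>
    intro K hK
    -- This bound covers both the original functions and the family in which one function is
    -- replaced by a product of two.
    obtain ⟨C, hC, h⟩ := ih (K + K * K) (by positivity)
    obtain ⟨D, hD⟩ : ∃ D, D = 2 ^ m * (C * C) + C := ⟨_, rfl⟩
    have hD0 : 0 ≤ D := by rw [hD]; positivity
    have hE0 : 0 ≤ (m + 1) * (m * D) := by positivity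
    refine ⟨K + (m + 1) * (m * D) + D, by positivity, fun n j g hg A hA hm => ?_⟩
    have hn : (1 : ℝ) ≤ n := by
      obtain ⟨a, _⟩ := hA
      exact_mod_cast (j a).pos
    have hKK : 0 ≤ K * K := by positivity
    have hb := h n j g fun α x => (hg α x).trans (by linarith)
    have hup : ∀ a b, CumulantBound j (Function.update g b (g a * g b)) m C := by
      refine fun a b => h n j _ fun α x => ?_
      by_cases hab : α = b
      · subst hab
        rw [Function.update_self, Pi.mul_apply, abs_mul]
        have := mul_le_mul (hg a x) (hg α x) (abs_nonneg _) hK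
        linarith
      · rw [Function.update_of_ne hab]
        exact (hg α x).trans (by linarith)
    suffices H : ∃ E, E ≤ K + (m + 1) * (m * D) + D ∧
        |setCumulant (permMoment j g) A| * (n : ℝ) ^ (A.image j).card ≤ E * n by
      obtain ⟨E, hE, hle⟩ := H
      exact hle.trans (mul_le_mul_of_nonneg_right hE (by linarith))
    by_cases hj : Set.InjOn j A
    · obtain ⟨i, hiA⟩ := hA
      obtain ⟨U, hiU, rfl⟩ : ∃ U, i ∉ U ∧ insert i U = A :=
        ⟨A.erase i, by simp, Finset.insert_erase hiA⟩
      rw [Finset.card_insert_of_notMem hiU] at hm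
      rcases U.eq_empty_or_nonempty with rfl | hU
      · refine ⟨K, by linarith, ?_⟩
        simp only [insert_empty_eq, Finset.image_singleton, Finset.card_singleton, pow_one]
        exact mul_le_mul_of_nonneg_right (abs_setCumulant_singleton_le j hg i) (by linarith)
      · refine ⟨(m + 1) * (m * D), by linarith, ?_⟩
        rw [hD]
        exact hb.of_injOn hn hC hup hiU hU (by omega) hj
    · simp only [Set.InjOn, not_forall] at hj
      obtain ⟨a, haA, b, hbA, hjab, hab⟩ := hj
      obtain ⟨B, ha, hb', rfl⟩ : ∃ B, a ∉ B ∧ b ∉ B ∧ insert a (insert b B) = A := by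
        refine ⟨(A.erase a).erase b, by simp, by simp, ?_⟩
        rw [Finset.insert_erase (Finset.mem_erase.2 ⟨Ne.symm hab, hbA⟩), Finset.insert_erase haA]
      rw [Finset.card_insert_of_notMem (by simp [hab, ha]),
        Finset.card_insert_of_notMem hb'] at hm
      refine ⟨D, by linarith, ?_⟩
      rw [hD]
      exact hb.of_eq hn hC hup hab ha hb' (by omega) hjab

end PermutationCumulants

/-! ### Counting letters of words: the incidence inequality and the number of words. -/

section Counting

/-- Identifying the values of `j` on each block of `ℬ` reduces the number of values by at most
`∑ A ∈ ℬ, (#j(A) - 1)`. -/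
theorem exists_collapse {α X : Type*} [Fintype α] [DecidableEq α] [DecidableEq X]
    (ℬ : Finset (Finset α)) : (∀ A ∈ ℬ, A.Nonempty) → ∀ j : α → X, ∃ j' : α → X,
      (∀ a b, j a = j b → j' a = j' b) ∧ (∀ A ∈ ℬ, ∀ a ∈ A, ∀ b ∈ A, j' a = j' b) ∧
      (Finset.univ.image j).card + ℬ.card ≤
        (Finset.univ.image j').card + ∑ A ∈ ℬ, (A.image j).card := by
  induction ℬ using Finset.induction_on with
  | empty => exact fun _ j => ⟨j, fun _ _ h => h, by simp, by simp⟩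
  | insert A ℬ hA ih =>
    intro hne j
    obtain ⟨a₀, ha₀⟩ := hne A (by simp)
    -- All letters on `A` are sent to the single letter `j a₀`. That letter survives, so at most
    -- `#j(A) - 1` letters are lost; this cannot increase the number of letters on the other blocks.
    set collapse : X → X := fun x => if x ∈ A.image j then j a₀ else x with hcollapse
    have hcollapseA : ∀ a ∈ A, collapse (j a) = j a₀ := fun a ha => if_pos (Finset.mem_image_of_mem j ha)
    obtain ⟨j', h1, h2, h3⟩ := ih (fun B hB => hne B (by simp [hB])) (fun a => collapse (j a))
    refine ⟨j', fun a b h => h1 a b (by simp only [h]), ?_, ?_⟩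
    · intro B hB a ha b hb
      rcases Finset.mem_insert.1 hB with rfl | hB
      · exact h1 a b (by simp only [hcollapseA a ha, hcollapseA b hb])
      · exact h2 B hB a ha b hb
    · rw [Finset.card_insert_of_notMem hA, Finset.sum_insert hA]
      have e1 : ∑ B ∈ ℬ, (B.image fun a => collapse (j a)).card ≤ ∑ B ∈ ℬ, (B.image j).card := by
        refine Finset.sum_le_sum fun B _ => ?_
        have : (B.image fun a => collapse (j a)) = (B.image j).image collapse := by
          rw [Finset.image_image]
          rfl
        rw [this]
        exact Finset.card_image_le
      have hmem : j a₀ ∈ Finset.univ.image fun a => collapse (j a) :=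
        Finset.mem_image.2 ⟨a₀, Finset.mem_univ _, hcollapseA a₀ ha₀⟩
      have e2 : Finset.univ.image j ⊆
          (Finset.univ.image fun a => collapse (j a)).erase (j a₀) ∪ A.image j := by
        intro x hx
        obtain ⟨a, -, rfl⟩ := Finset.mem_image.1 hx
        rw [Finset.mem_union]
        by_cases hxA : j a ∈ A.image j
        · exact Or.inr hxA
        · refine Or.inl (Finset.mem_erase.2 ⟨fun h => hxA ?_, ?_⟩)
          · exact h ▸ Finset.mem_image_of_mem j ha₀
          · exact Finset.mem_image.2 ⟨a, Finset.mem_univ _, if_neg hxA⟩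
      have e3 := (Finset.card_le_card e2).trans (Finset.card_union_le _ _)
      have e4 := Finset.card_erase_add_one hmem
      omega

/-- The number of words with a given number of distinct letters, in weighted form. -/
theorem sum_inv_pow_card_image_le (N n : ℕ) :
    ∑ j : Fin N → Fin n, ((n : ℝ) ^ (Finset.univ.image j).card)⁻¹ ≤ (N + 1) * (N : ℝ) ^ N := by
  -- A set of `m` letters is the image of at most `m ^ N ≤ N ^ N` words, and of none when `m > N`.
  -- The weight `n ^ (-m)` compensates for the at most `n ^ m` sets of that size.
  set F : ℕ → ℝ := fun m => if m ≤ N then (N : ℝ) ^ N * ((n : ℝ) ^ m)⁻¹ else 0 with hF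
  have h1 : ∀ S : Finset (Fin n), ∑ j ∈ (Finset.univ : Finset (Fin N → Fin n)) with
      Finset.univ.image j = S, ((n : ℝ) ^ (Finset.univ.image j).card)⁻¹ ≤ F S.card := by
    intro S
    have hconst : ∑ j ∈ (Finset.univ : Finset (Fin N → Fin n)) with
        Finset.univ.image j = S, ((n : ℝ) ^ (Finset.univ.image j).card)⁻¹ =
        ((Finset.univ : Finset (Fin N → Fin n)).filter
          (fun j => Finset.univ.image j = S)).card * ((n : ℝ) ^ S.card)⁻¹ := by
      rw [← nsmul_eq_mul, ← Finset.sum_const]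
      refine Finset.sum_congr rfl fun j hj => ?_
      rw [(Finset.mem_filter.1 hj).2]
    rw [hconst, hF]
    simp only
    split_ifs with hS
    · gcongr
      have hsub : (Finset.univ : Finset (Fin N → Fin n)).filter
          (fun j => Finset.univ.image j = S) ⊆ Fintype.piFinset fun _ => S := by
        intro j hj
        rw [Fintype.mem_piFinset]
        intro a
        rw [← (Finset.mem_filter.1 hj).2]
        exact Finset.mem_image_of_mem j (Finset.mem_univ a)
      have := Finset.card_le_card hsub
      rw [Fintype.card_piFinset_const] at this
      exact_mod_cast this.trans (Nat.pow_le_pow_left hS N)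
    · have : (Finset.univ : Finset (Fin N → Fin n)).filter
          (fun j => Finset.univ.image j = S) = ∅ := by
        refine Finset.filter_eq_empty_iff.2 fun j _ hj => hS ?_
        rw [← hj]
        exact Finset.card_image_le.trans (by simp)
      rw [this]
      simp
  calc _ = ∑ S : Finset (Fin n), ∑ j ∈ (Finset.univ : Finset (Fin N → Fin n)) with
        Finset.univ.image j = S, ((n : ℝ) ^ (Finset.univ.image j).card)⁻¹ :=
        (Finset.sum_fiberwise _ _ _).symm
    _ ≤ ∑ S : Finset (Fin n), F S.card := Finset.sum_le_sum fun S _ => h1 S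
    _ = ∑ m ∈ Finset.range (n + 1), n.choose m • F m := by
        rw [← Finset.powerset_univ, Finset.sum_powerset_apply_card, Finset.card_univ,
          Fintype.card_fin]
    _ ≤ ∑ m ∈ Finset.range (n + 1), if m ≤ N then (N : ℝ) ^ N else 0 := by
        refine Finset.sum_le_sum fun m hm => ?_
        rw [hF, nsmul_eq_mul]
        simp only
        split_ifs with h
        · have hc : (n.choose m : ℝ) ≤ (n : ℝ) ^ m := by exact_mod_cast Nat.choose_le_pow n m
          calc (n.choose m : ℝ) * ((N : ℝ) ^ N * ((n : ℝ) ^ m)⁻¹) ≤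
              (n : ℝ) ^ m * ((N : ℝ) ^ N * ((n : ℝ) ^ m)⁻¹) := by gcongr
            _ = (N : ℝ) ^ N * ((n : ℝ) ^ m / (n : ℝ) ^ m) := by ring
            _ ≤ (N : ℝ) ^ N * 1 := by gcongr; exact div_self_le_one _
            _ = _ := mul_one _
        · simp
    _ = ∑ m ∈ (Finset.range (n + 1)).filter (fun m => m ≤ N), (N : ℝ) ^ N :=
        (Finset.sum_filter _ _).symm
    _ ≤ ∑ m ∈ Finset.range (N + 1), (N : ℝ) ^ N := by
        refine Finset.sum_le_sum_of_subset_of_nonneg ?_ fun _ _ _ => by positivity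
        intro m hm
        have := (Finset.mem_filter.1 hm).2
        simp only [Finset.mem_range]
        omega
    _ = (N + 1) * (N : ℝ) ^ N := by simp

variable {N : ℕ}

theorem nonempty_of_mem_blocks {π : Setoid (Fin N)} {A : Finset (Fin N)} (hA : A ∈ blocks π) :
    A.Nonempty := by
  unfold blocks at hA
  exact Finpartition.nonempty_of_mem_parts _ hA

theorem exists_mem_blocks (π : Setoid (Fin N)) (a : Fin N) : ∃ A ∈ blocks π, a ∈ A := by
  unfold blocks
  exact Finpartition.exists_mem _ (Finset.mem_univ a)

theorem rel_iff_mem_of_mem_blocks {π : Setoid (Fin N)} {A : Finset (Fin N)} (hA : A ∈ blocks π)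
    {a b : Fin N} (ha : a ∈ A) : π a b ↔ b ∈ A := by
  classical
  unfold blocks at hA
  rw [← Finpartition.mem_part_ofSetoid_iff_rel, ← Finpartition.part_eq_of_mem _ hA ha]

theorem card_image_le_numBlocks {X : Type*} [DecidableEq X] {ρ : Setoid (Fin N)} {j : Fin N → X}
    (hj : ρ ≤ Setoid.ker j) : (Finset.univ.image j).card ≤ numBlocks ρ := by
  have hsub : Finset.univ.image j ⊆ (blocks ρ).attach.image
      (fun A => j (nonempty_of_mem_blocks A.2).choose) := by
    intro x hx
    obtain ⟨a, -, rfl⟩ := Finset.mem_image.1 hx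
    obtain ⟨A, hA, ha⟩ := exists_mem_blocks ρ a
    refine Finset.mem_image.2 ⟨⟨A, hA⟩, Finset.mem_attach _ _, ?_⟩
    exact hj ((rel_iff_mem_of_mem_blocks hA (nonempty_of_mem_blocks hA).choose_spec).2 ha)
  calc _ ≤ _ := Finset.card_le_card hsub
    _ ≤ (blocks ρ).attach.card := Finset.card_image_le
    _ = numBlocks ρ := Finset.card_attach

/-- If `j` is constant on the classes of `σ`, then the bipartite incidence graph between the letters
of `j` and the blocks of `π` has at most `#(σ ⊔ π)` components. -/
theorem card_image_add_numBlocks_le {X : Type*} [DecidableEq X] {σ π : Setoid (Fin N)}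
    {j : Fin N → X} (hj : σ ≤ Setoid.ker j) :
    (Finset.univ.image j).card + (blocks π).card ≤
      numBlocks (σ ⊔ π) + ∑ A ∈ blocks π, (A.image j).card := by
  obtain ⟨j', h1, h2, h3⟩ := exists_collapse (blocks π) (fun A => nonempty_of_mem_blocks) j
  refine h3.trans (Nat.add_le_add_right (card_image_le_numBlocks (sup_le ?_ ?_)) _)
  · exact fun a b h => h1 a b (hj h)
  · intro a b h
    obtain ⟨A, hA, ha⟩ := exists_mem_blocks π a
    exact h2 A hA a ha b ((rel_iff_mem_of_mem_blocks hA ha).1 h)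

theorem mem_measurableWords {π : Setoid (Fin N)} {n : ℕ} {j : Fin N → Fin n} :
    j ∈ measurableWords π n ↔ π ≤ Setoid.ker j := by
  unfold measurableWords
  refine (@Finset.mem_filter _ _ (Classical.decPred _) _ _).trans ?_
  exact ⟨fun h a b hab => h.2 a b hab, fun h => ⟨Finset.mem_univ _, fun a b hab => h hab⟩⟩

end Counting

/-! ### Standardized ranks and the sum over words. -/

/-- The value of `Z_i` as a function of the (zero-based) rank. -/
noncomputable def standardizedRank (n : ℕ) (x : Fin n) : ℝ :=
  Real.sqrt (12 / ((n : ℝ) ^ 2 - 1)) * ((((x : ℕ) : ℝ) + 1) - ((n : ℝ) + 1) / 2)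

theorem abs_standardizedRank_le {n : ℕ} (hn : 2 ≤ n) (x : Fin n) :
    |standardizedRank n x| ≤ 2 := by
  have hn' : (2 : ℝ) ≤ n := by exact_mod_cast hn
  have hx0 : (0 : ℝ) ≤ (x : ℕ) := by positivity
  have hx1 : ((x : ℕ) : ℝ) + 1 ≤ n := by exact_mod_cast x.2
  have hpos : (0 : ℝ) < (n : ℝ) ^ 2 - 1 := by nlinarith
  refine abs_le_of_sq_le_sq ?_ (by norm_num)
  rw [standardizedRank, mul_pow, Real.sq_sqrt (by positivity), div_mul_eq_mul_div,
    div_le_iff₀ hpos]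
  have hy : ((((x : ℕ) : ℝ) + 1) - ((n : ℝ) + 1) / 2) ^ 2 ≤ (((n : ℝ) - 1) / 2) ^ 2 :=
    sq_le_sq' (by linarith) (by linarith)
  -- The claim reduces to `3 (n - 1)² ≤ 4 (n² - 1)`.
  nlinarith

theorem exists_jointCumulant_Z_bound {ι : Type*} [DecidableEq ι] (A : Finset ι)
    (hA : A.Nonempty) : ∃ C : ℝ, 0 ≤ C ∧ ∀ n : ℕ, 2 ≤ n → ∀ j : ι → Fin n,
      |jointCumulant A (fun a => Z n (j a))| ≤ C * (n / (n : ℝ) ^ (A.image j).card) := by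
  obtain ⟨C, hC, h⟩ := exists_cumulantBound (ι := ι) A.card 2 (by norm_num)
  refine ⟨C, hC, fun n hn j => ?_⟩
  have hn0 : (0 : ℝ) < n := by exact_mod_cast (by omega : 0 < n)
  have := h n j (fun _ => standardizedRank n) (fun _ => abs_standardizedRank_le hn) A hA le_rfl
  rw [jointCumulant_eq_setCumulant, ← mul_div_assoc, le_div_iff₀ (by positivity)]
  exact this

theorem exists_cumulantProduct_bound {N : ℕ} (σ π : Setoid (Fin N)) :
    ∃ C : ℝ, 0 ≤ C ∧ ∀ n : ℕ, 2 ≤ n → ∀ j ∈ measurableWords σ n,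
      |cumulantProduct π j| ≤
        C * ((n : ℝ) ^ numBlocks (σ ⊔ π) * ((n : ℝ) ^ (Finset.univ.image j).card)⁻¹) := by
  have hex : ∀ A : Finset (Fin N), ∃ C : ℝ, 0 ≤ C ∧ (A.Nonempty → ∀ n : ℕ, 2 ≤ n →
      ∀ j : Fin N → Fin n, |jointCumulant A (fun a => Z n (j a))| ≤
        C * (n / (n : ℝ) ^ (A.image j).card)) := by
    intro A
    by_cases hA : A.Nonempty
    · obtain ⟨C, hC, h⟩ := exists_jointCumulant_Z_bound A hA
      exact ⟨C, hC, fun _ => h⟩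
    · exact ⟨0, le_rfl, fun h => absurd h hA⟩
  choose C hC h using hex
  refine ⟨∏ A ∈ blocks π, C A, Finset.prod_nonneg fun A _ => hC A, fun n hn j hj => ?_⟩
  have hn1 : (1 : ℝ) ≤ n := by exact_mod_cast (by omega : 1 ≤ n)
  have hn0 : (0 : ℝ) < n := by linarith
  calc |cumulantProduct π j| = ∏ A ∈ blocks π, |jointCumulant A (fun a => Z n (j a))| := by
        rw [cumulantProduct, Finset.abs_prod]
    _ ≤ ∏ A ∈ blocks π, C A * (n / (n : ℝ) ^ (A.image j).card) :=
        Finset.prod_le_prod (fun _ _ => abs_nonneg _)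
          fun A hA => h A (nonempty_of_mem_blocks hA) n hn j
    _ = (∏ A ∈ blocks π, C A) *
          ((n : ℝ) ^ (blocks π).card / (n : ℝ) ^ ∑ A ∈ blocks π, (A.image j).card) := by
        rw [Finset.prod_mul_distrib, Finset.prod_div_distrib, Finset.prod_const,
          Finset.prod_pow_eq_pow_sum]
    _ ≤ _ := by
        refine mul_le_mul_of_nonneg_left ?_ (Finset.prod_nonneg fun A _ => hC A)
        -- After clearing denominators, the comparison of exponents is exactly the incidence
        -- inequality.
        rw [← div_eq_mul_inv, div_le_div_iff₀ (by positivity) (by positivity), ← pow_add,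
          ← pow_add]
        refine pow_le_pow_right₀ hn1 ?_
        have := card_image_add_numBlocks_le (π := π) (mem_measurableWords.1 hj)
        omega

/-- The absolute values of the products of cumulants over the blocks of `π`, summed over the
`σ`-measurable words, are `O(n ^ #(σ ⊔ π))`. -/
theorem sum_abs_cumulantProduct_isBigO {N : ℕ} (σ π : Setoid (Fin N)) :
    (fun n : ℕ => ∑ j ∈ measurableWords σ n, |cumulantProduct π j|) =O[atTop]
      (fun n : ℕ => (n : ℝ) ^ numBlocks (σ ⊔ π)) := by
  obtain ⟨C, hC, h⟩ := exists_cumulantProduct_bound σ π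
  refine IsBigO.of_bound (C * ((N + 1) * (N : ℝ) ^ N)) ?_
  filter_upwards [eventually_ge_atTop 2] with n hn
  rw [Real.norm_of_nonneg (Finset.sum_nonneg fun _ _ => abs_nonneg _),
    Real.norm_of_nonneg (by positivity)]
  calc _ ≤ ∑ j ∈ measurableWords σ n,
        C * ((n : ℝ) ^ numBlocks (σ ⊔ π) * ((n : ℝ) ^ (Finset.univ.image j).card)⁻¹) :=
        Finset.sum_le_sum fun j hj => h n hn j hj
    _ ≤ ∑ j : Fin N → Fin n,
        C * ((n : ℝ) ^ numBlocks (σ ⊔ π) * ((n : ℝ) ^ (Finset.univ.image j).card)⁻¹) :=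
        Finset.sum_le_sum_of_subset_of_nonneg (Finset.subset_univ _)
          fun _ _ _ => by positivity
    _ = C * (n : ℝ) ^ numBlocks (σ ⊔ π) *
        ∑ j : Fin N → Fin n, ((n : ℝ) ^ (Finset.univ.image j).card)⁻¹ := by
        rw [Finset.mul_sum]
        exact Finset.sum_congr rfl fun _ _ => by ring
    _ ≤ C * (n : ℝ) ^ numBlocks (σ ⊔ π) * ((N + 1) * (N : ℝ) ^ N) := by
        gcongr
        exact sum_inv_pow_card_image_le N n
    _ = _ := by ring

end Spearman

theorem corollary4p3 {r : ℕ} (κ : Fin r → ℕ) (π : Setoid (Fin (2 * ∑ i, κ i)))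
    (hπ : Spearman.IsEvenPartition π) :
    (fun n : ℕ => ∑ j ∈ Spearman.measurableWords (Spearman.pi1 κ) n,
        |Spearman.cumulantProduct π j|) =O[atTop]
      (fun n : ℕ => (n : ℝ) ^ (Spearman.numBlocks (Spearman.pi1 κ ⊔ π) +
        ∑ γ ∈ Finset.Icc 2 (∑ i, κ i), (γ - 2) * Spearman.numBlocksOfHalfSize π γ)) := by
  -- The sum over `γ` only enlarges the exponent, so the bound with exponent `#(π_1 ∨ π)` suffices.
  refine (Spearman.sum_abs_cumulantProduct_isBigO (Spearman.pi1 κ) π).trans ?_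
  refine IsBigO.of_bound 1 ?_
  filter_upwards [eventually_ge_atTop 1] with n hn
  rw [one_mul, Real.norm_of_nonneg (by positivity), Real.norm_of_nonneg (by positivity)]
  exact pow_le_pow_right₀ (by exact_mod_cast hn) (Nat.le_add_right _ _)
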